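/- Let $(G_i)_{i\in I}$ be a family of groups with a common subgroup $C$, and let $G=\ast_C G_i$ be their amalgam, i.e. the free product of the $G_i$ amalgamated along $C$; regard each $G_i$ as a subgroup of $G$. A (possibly empty) subsemigroup $P$ of a group $H$ is called normal if $h^{-1}xh\in P$ for all $x\in P$ and $h\in H$. For a subset $S$ of a group $H$ let $$\mathrm{NSS}_H(S)=\{\,s_1^{h_1}\cdots s_n^{h_n} \mid n\ge 1,\ s_k\in S,\ h_k\in H\,\},\qquad s^h:=h^{-1}sh,$$ be the normal subsemigroup of $H$ generated by $S$. Fix $i_0\in I$ and let $R\subseteq G_{i_0}\setminus\{1\}$. Then $1\notin \mathrm{NSS}_G(R)$ if and only if there exists, for each $j\in I$, a normal subsemigroup $P_j$ of $G_j$ such that $R\subseteq P_{i_0}$, $1\notin P_{i_0}$, and $P_j\cap C=P_{j'}\cap C$ for all $j,j'\in I$. -/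

import Mathlib

/-- A (possibly empty) subsemigroup `P` of a group `G` is normal if it is closed under
conjugation `x ↦ x ^ g = g⁻¹ x g` by every element of `G`. -/
def IsNormalSubsemigroup {G : Type*} [Group G] (P : Subsemigroup G) : Prop :=
  ∀ x ∈ P, ∀ g : G, g⁻¹ * x * g ∈ P

/-- `NSS S` is the normal subsemigroup of `G` generated by `S`, i.e. the set of all products
`s₁ ^ g₁ ⋯ sₙ ^ gₙ` with `n ≥ 1`, `sᵢ ∈ S`, `gᵢ ∈ G`, where `s ^ g = g⁻¹ s g`.
The pairs `(sᵢ, gᵢ)` are the entries of the nonempty list `l`. -/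
def NSS {G : Type*} [Group G] (S : Set G) : Set G :=
  {x | ∃ l : List (G × G), l ≠ [] ∧ (∀ p ∈ l, p.1 ∈ S) ∧
    (l.map fun p => p.2⁻¹ * p.1 * p.2).prod = x}

/-! Forward, intersect `NSS` of `R` with each factor. Conversely, `A i = P i ∪ {1}` is the cone of a
bi-invariant preorder on `G i`, and these cones must extend to a normal submonoid `N` of the amalgam
that meets each `G i` in exactly `A i`. Take for `N` the elements represented by words dominating 1.
A leading letter can always be moved to the other side (`cons_iff`), and domination of elements of
`C` does not depend on the factor (`base_change`), so the factors map compatibly to the syntactic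
monoid of this set of words. Membership then depends only on the element represented
(`isNonneg_congr`). If a product of conjugates of `R` is 1, then some `r⁻¹` with `r ∈ R` lies in
`N`, hence in `A i₀`, which is impossible. -/

namespace Monoid.PushoutI

variable {I : Type*} {G : I → Type*} {C : Type*} [∀ i, Group (G i)] [Group C]

/-- For a family of submonoids `A i` of `G i`, viewed as the cones of elements `≥ 1`, the word `w`
dominates `g : G i` if `g ≤ w` can be derived by splitting off subwords of `w` that dominate
elements of `C`. -/
inductive Dominates (φ : ∀ i, C →* G i) (A : ∀ i, Submonoid (G i)) :
    ∀ i, List (Σ i, G i) → G i → Prop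
  | nil {i : I} {g : G i} : g⁻¹ ∈ A i → Dominates φ A i [] g
  | cons {i : I} {h g : G i} {w : List (Σ i, G i)} :
      Dominates φ A i w (h⁻¹ * g) → Dominates φ A i (⟨i, h⟩ :: w) g
  | nest {i j : I} {g : G i} {u w : List (Σ i, G i)} (c : C) :
      Dominates φ A j u (φ j c) → Dominates φ A i w ((φ i c)⁻¹ * g) →
      Dominates φ A i (u ++ w) g

/-- A family of normal submonoids `A i` of the `G i` having the same trace on `C`. -/
structure IsCompatible (φ : ∀ i, C →* G i) (A : ∀ i, Submonoid (G i)) : Prop where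
  conj_mem : ∀ i, ∀ x ∈ A i, ∀ g : G i, g⁻¹ * x * g ∈ A i
  trace : ∀ i j c, φ i c ∈ A i → φ j c ∈ A j

variable {φ : ∀ i, C →* G i} {A : ∀ i, Submonoid (G i)}

/-! ### Calculus of domination -/

namespace Dominates

theorem mul_inv_right {i : I} {w : List (Σ i, G i)} {g a : G i} (h : Dominates φ A i w g)
    (ha : a ∈ A i) : Dominates φ A i w (g * a⁻¹) := by
  induction h with
  | nil h => exact nil (by simpa using mul_mem ha h)
  | cons _ ih => exact cons (by simpa only [mul_assoc] using ih ha)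
  | nest c hu _ _ ih => exact nest c hu (by simpa only [mul_assoc] using ih ha)

theorem of_inv_mul (hA : IsCompatible φ A) {i : I} {w : List (Σ i, G i)} {g a : G i}
    (h : Dominates φ A i w (a⁻¹ * g)) (ha : a⁻¹ ∈ A i) : Dominates φ A i w g := by
  have := h.mul_inv_right (hA.conj_mem i _ ha g)
  convert this using 1
  group

theorem inv_mem_of_nil (hA : IsCompatible φ A) {i : I} {g : G i}
    (h : Dominates φ A i [] g) : g⁻¹ ∈ A i := by
  generalize hw : ([] : List (Σ i, G i)) = w at h
  induction h with
  | nil h => exact h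
  | cons => simp at hw
  | @nest i j g u w c _ _ ihu ihw =>
    obtain ⟨rfl, rfl⟩ : u = [] ∧ w = [] := by simpa using hw.symm
    have h₁ : φ i c⁻¹ ∈ A i := hA.trace j i _ (by simpa using ihu rfl)
    have h₂ := mul_mem (ihw rfl) h₁
    simpa using h₂

theorem append (hA : IsCompatible φ A) {i : I} {w w' : List (Σ i, G i)} {a b : G i}
    (h : Dominates φ A i w a) (h' : Dominates φ A i w' b) :
    Dominates φ A i (w ++ w') (a * b) := by
  induction h with
  | nil h => exact of_inv_mul hA (by simpa using h') h
  | cons _ ih =>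
    rw [List.cons_append]
    exact cons (by simpa only [mul_assoc] using ih h')
  | nest c hu _ _ ih =>
    rw [List.append_assoc]
    exact nest c hu (by simpa only [mul_assoc] using ih h')

/-- In a derivation the first letter is split off either at the outer level or inside a block
dominating some `c : C`; nested blocks starting with it merge into one. -/
theorem cons_cases (hA : IsCompatible φ A) {i k : I} {h : G k} {w : List (Σ i, G i)} {g : G i}
    (H : Dominates φ A i (⟨k, h⟩ :: w) g) :
    (∃ h' : G i, (⟨k, h⟩ : Σ i, G i) = ⟨i, h'⟩ ∧ Dominates φ A i w (h'⁻¹ * g)) ∨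
      ∃ w₁ w₂ c, w = w₁ ++ w₂ ∧ Dominates φ A k w₁ (h⁻¹ * φ k c) ∧
        Dominates φ A i w₂ ((φ i c)⁻¹ * g) := by
  generalize hw : (⟨k, h⟩ :: w : List (Σ i, G i)) = w' at H
  induction H generalizing w with
  | nil => simp at hw
  | cons H ih =>
    obtain ⟨h₁, rfl⟩ := List.cons.inj hw
    exact Or.inl ⟨_, h₁, H⟩
  | @nest i j g u v c hu hv ihu ihv =>
    rcases u with _ | ⟨x, u⟩
    -- An empty block forces `c ≤ 1`, so it can be absorbed by normality.
    · have hc : (φ i c)⁻¹ ∈ A i := by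
        rw [← map_inv]
        exact hA.trace j i _ (by simpa using inv_mem_of_nil hA hu)
      rcases ihv hw with ⟨h', e, H⟩ | ⟨w₁, w₂, d, e, H₁, H₂⟩
      · refine Or.inl ⟨h', e, ?_⟩
        have := H.mul_inv_right (hA.conj_mem i _ hc g)
        convert this using 1
        group
      · refine Or.inr ⟨w₁, w₂, d, e, H₁, ?_⟩
        have := H₂.mul_inv_right (hA.conj_mem i _ hc g)
        convert this using 1
        group
    · obtain ⟨rfl, rfl⟩ := List.cons.inj hw
      rcases ihu rfl with ⟨h', e, H⟩ | ⟨w₁, w₂, d, rfl, H₁, H₂⟩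
      · cases e
        exact Or.inr ⟨u, v, c, rfl, H, hv⟩
      · refine Or.inr ⟨w₁, w₂ ++ v, d, by simp, H₁, ?_⟩
        -- The rest of the inner block dominates `d⁻¹ * c` and becomes a block of its own in front
        -- of `v`.
        exact nest (d⁻¹ * c) (by simpa using H₂) (by simpa [mul_assoc] using hv)

theorem cons_iff (hA : IsCompatible φ A) {i : I} {h g : G i} {w : List (Σ i, G i)} :
    Dominates φ A i (⟨i, h⟩ :: w) g ↔ Dominates φ A i w (h⁻¹ * g) := by
  refine ⟨fun H => ?_, cons⟩
  rcases H.cons_cases hA with ⟨h', e, H⟩ | ⟨w₁, w₂, c, rfl, H₁, H₂⟩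
  · cases e
    exact H
  · simpa [mul_assoc] using H₁.append hA H₂

theorem base_change {i : I} (j : I) {w : List (Σ i, G i)} {c : C}
    (h : Dominates φ A i w (φ i c)) : Dominates φ A j w (φ j c) := by
  simpa using nest (w := []) (g := φ j c) c h (nil (by simp))

end Dominates

/-! ### Nonnegative words and their syntactic monoid -/

/-- The word `w` dominates the identity. -/
def IsNonneg (φ : ∀ i, C →* G i) (A : ∀ i, Submonoid (G i)) (w : List (Σ i, G i)) : Prop :=
  ∃ i, Dominates φ A i w 1

theorem IsNonneg.dominates {w : List (Σ i, G i)} (h : IsNonneg φ A w) (i : I) :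
    Dominates φ A i w 1 := by
  obtain ⟨j, h⟩ := h
  have h' : Dominates φ A j w (φ j 1) := by rwa [map_one]
  simpa only [map_one] using h'.base_change i

theorem isNonneg_cons_iff (hA : IsCompatible φ A) {i : I} {h : G i} {w : List (Σ i, G i)} :
    IsNonneg φ A (⟨i, h⟩ :: w) ↔ Dominates φ A i w h⁻¹ := by
  have key := Dominates.cons_iff hA (h := h) (g := 1) (w := w)
  rw [mul_one] at key
  exact ⟨fun H => key.1 (H.dominates i), fun H => ⟨i, key.2 H⟩⟩

theorem IsNonneg.rotate (hA : IsCompatible φ A) {u v : List (Σ i, G i)}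
    (h : IsNonneg φ A (u ++ v)) : IsNonneg φ A (v ++ u) := by
  induction u generalizing v with
  | nil => simpa using h
  | cons x u ih =>
    obtain ⟨i, g⟩ := x
    have h₁ := (isNonneg_cons_iff hA).1 h
    have h₂ : Dominates φ A i [⟨i, g⟩] g := .cons (.nil (by simp))
    have h₃ : IsNonneg φ A (u ++ (v ++ [⟨i, g⟩])) := ⟨i, by simpa using h₁.append hA h₂⟩
    simpa using ih h₃

theorem isNonneg_append_comm (hA : IsCompatible φ A) {u v : List (Σ i, G i)} :
    IsNonneg φ A (u ++ v) ↔ IsNonneg φ A (v ++ u) :=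
  ⟨.rotate hA, .rotate hA⟩

/-- The syntactic congruence of the set of words dominating the identity. -/
def syntacticCon (hA : IsCompatible φ A) : Con (FreeMonoid (Σ i, G i)) where
  r w w' := ∀ v, IsNonneg φ A (w * v).toList ↔ IsNonneg φ A (w' * v).toList
  iseqv := ⟨fun _ _ => Iff.rfl, fun h v => (h v).symm, fun h h' v => (h v).trans (h' v)⟩
  mul' := by
    -- Right contexts suffice, because nonnegativity is invariant under rotation.
    intro w x y z h h' v
    rw [mul_assoc, h, mul_assoc, FreeMonoid.toList_mul, isNonneg_append_comm hA,
      ← FreeMonoid.toList_mul, mul_assoc, h', ← mul_assoc, FreeMonoid.toList_mul,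
      isNonneg_append_comm hA, ← FreeMonoid.toList_mul]

/-- The element of the amalgam represented by a word. -/
def eval (φ : ∀ i, C →* G i) : FreeMonoid (Σ i, G i) →* PushoutI φ :=
  FreeMonoid.lift fun x => of x.1 x.2

theorem eval_surjective [Nonempty I] : Function.Surjective (eval φ) := by
  intro x
  induction x using PushoutI.induction_on with
  | of i g => exact ⟨FreeMonoid.of ⟨i, g⟩, by simp [eval]⟩
  | base c =>
    obtain ⟨i⟩ := ‹Nonempty I›
    exact ⟨FreeMonoid.of ⟨i, φ i c⟩, by simp [eval, of_apply_eq_base]⟩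
  | mul x y hx hy =>
    obtain ⟨u, rfl⟩ := hx
    obtain ⟨v, rfl⟩ := hy
    exact ⟨u * v, map_mul _ _ _⟩

/-- The map from `G i` to the syntactic monoid. -/
def toSyntactic (hA : IsCompatible φ A) (i : I) : G i →* (syntacticCon hA).Quotient where
  toFun g := (FreeMonoid.of ⟨i, g⟩ : FreeMonoid (Σ i, G i))
  map_one' := (Con.eq _).2 fun v => by
    simp only [FreeMonoid.toList_mul, FreeMonoid.toList_of, List.singleton_append,
      isNonneg_cons_iff hA, FreeMonoid.toList_one, List.nil_append, inv_one]
    exact ⟨fun h => ⟨i, h⟩, fun h => h.dominates i⟩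
  map_mul' g h := (Con.eq _).2 fun v => by
    simp only [FreeMonoid.toList_mul, FreeMonoid.toList_of,
      isNonneg_cons_iff hA, List.cons_append, Dominates.cons_iff hA, List.nil_append,
      mul_inv_rev]

theorem toSyntactic_base (hA : IsCompatible φ A) (i j : I) (c : C) :
    toSyntactic hA i (φ i c) = toSyntactic hA j (φ j c) :=
  (Con.eq _).2 fun v => by
    simp only [FreeMonoid.toList_mul, FreeMonoid.toList_of, List.singleton_append,
      isNonneg_cons_iff hA, ← map_inv]
    exact ⟨.base_change j, .base_change i⟩

theorem isNonneg_congr [Nonempty I] (hA : IsCompatible φ A) {w w' : FreeMonoid (Σ i, G i)}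
    (h : eval φ w = eval φ w') : IsNonneg φ A w.toList ↔ IsNonneg φ A w'.toList := by
  obtain ⟨i₀⟩ := ‹Nonempty I›
  let f : PushoutI φ →* (syntacticCon hA).Quotient :=
    lift (toSyntactic hA) ((toSyntactic hA i₀).comp (φ i₀)) fun i =>
      MonoidHom.ext fun c => toSyntactic_base hA i i₀ c
  have hf : f.comp (eval φ) = (syntacticCon hA).mk' := by
    ext x
    simp only [f, eval, MonoidHom.comp_apply, FreeMonoid.lift_eval_of, lift_of]
    rfl
  have key : (syntacticCon hA).mk' w = (syntacticCon hA).mk' w' := by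
    rw [← hf, MonoidHom.comp_apply, h, MonoidHom.comp_apply]
  simpa using (Con.eq _).1 key 1

/-- Compatible normal submonoids of the factors extend to a normal submonoid of the amalgam. -/
theorem exists_normal_submonoid [Nonempty I] (hA : IsCompatible φ A) :
    ∃ N : Submonoid (PushoutI φ), (∀ x ∈ N, ∀ g, g⁻¹ * x * g ∈ N) ∧
      ∀ i (g : G i), of i g ∈ N ↔ g ∈ A i := by
  refine ⟨{ carrier := {x | ∃ w, eval φ w = x ∧ IsNonneg φ A w.toList}
            one_mem' := ?_
            mul_mem' := ?_ }, ?_, ?_⟩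
  · rintro _ _ ⟨u, rfl, i, hu⟩ ⟨v, rfl, hv⟩
    exact ⟨u * v, map_mul _ _ _, i, by simpa using hu.append hA (hv.dominates i)⟩
  · obtain ⟨i⟩ := ‹Nonempty I›
    exact ⟨1, map_one _, i, .nil (by simp)⟩
  · rintro _ ⟨w, rfl, hw⟩ g
    obtain ⟨u, rfl⟩ := eval_surjective g
    obtain ⟨u', hu'⟩ := eval_surjective (eval φ u)⁻¹
    refine ⟨u' * w * u, by simp [hu'], ?_⟩
    rw [mul_assoc, FreeMonoid.toList_mul, isNonneg_append_comm hA, ← FreeMonoid.toList_mul]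
    refine (isNonneg_congr hA ?_).1 hw
    simp [hu']
  · intro i g
    have key : IsNonneg φ A (FreeMonoid.of ⟨i, g⟩ : FreeMonoid (Σ i, G i)).toList ↔ g ∈ A i := by
      rw [FreeMonoid.toList_of, isNonneg_cons_iff hA]
      exact ⟨fun h => by simpa using h.inv_mem_of_nil hA, fun h => .nil (by simpa using h)⟩
    rw [← key]
    constructor
    · rintro ⟨w, hw, h⟩
      exact (isNonneg_congr hA (by simpa [eval] using hw)).1 h
    · exact fun h => ⟨_, by simp [eval], h⟩

end Monoid.PushoutI

/-! ### Normal subsemigroups and the criterion -/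

section NSS

variable {H : Type*} [Group H] {S : Set H}

theorem subset_NSS : S ⊆ NSS S := fun s hs => ⟨[(s, 1)], by simp, by simpa using hs, by simp⟩

theorem mul_mem_NSS {x y : H} (hx : x ∈ NSS S) (hy : y ∈ NSS S) : x * y ∈ NSS S := by
  obtain ⟨l, hl, hlS, rfl⟩ := hx
  obtain ⟨m, -, hmS, rfl⟩ := hy
  refine ⟨l ++ m, by simp [hl], fun p hp => ?_, by simp⟩
  exact (List.mem_append.1 hp).elim (hlS p) (hmS p)

theorem conj_mem_NSS {x : H} (hx : x ∈ NSS S) (g : H) : g⁻¹ * x * g ∈ NSS S := by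
  obtain ⟨l, hl, hlS, rfl⟩ := hx
  refine ⟨l.map fun p => (p.1, p.2 * g), by simpa using hl, ?_, ?_⟩
  · intro p hp
    obtain ⟨q, hq, rfl⟩ := List.mem_map.1 hp
    exact hlS q hq
  · have := map_list_prod (MulAut.conj g⁻¹) (l.map fun p => p.2⁻¹ * p.1 * p.2)
    rw [MulAut.conj_apply, inv_inv] at this
    rw [this, List.map_map, List.map_map]
    congr 2
    ext p
    simp [mul_assoc]

end NSS

/-- The submonoid `P ∪ {1}`. -/
def Subsemigroup.insertOne {H : Type*} [Group H] (P : Subsemigroup H) : Submonoid H where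
  carrier := {x | x = 1 ∨ x ∈ P}
  one_mem' := Or.inl rfl
  mul_mem' := by
    rintro x y (rfl | hx) (rfl | hy)
    · simp
    · simpa using Or.inr hy
    · simpa using Or.inr hx
    · exact Or.inr (mul_mem hx hy)

theorem theoremT {I : Type*} {G : I → Type*} {C : Type*} [∀ i, Group (G i)] [Group C]
    (φ : ∀ i, C →* G i) (hφ : ∀ i, Function.Injective (φ i))
    (i₀ : I) (R : Set (G i₀)) (hR : (1 : G i₀) ∉ R) :
    (1 : Monoid.PushoutI φ) ∉
        NSS ((Monoid.PushoutI.of i₀ : G i₀ →* Monoid.PushoutI φ) '' R) ↔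
      ∃ P : ∀ j, Subsemigroup (G j),
        (∀ j, IsNormalSubsemigroup (P j)) ∧
        R ⊆ (P i₀ : Set (G i₀)) ∧
        (1 : G i₀) ∉ P i₀ ∧
        ∀ j j' : I, φ j ⁻¹' (P j : Set (G j)) = φ j' ⁻¹' (P j' : Set (G j')) := by
  constructor
  · intro h
    let N : Subsemigroup (Monoid.PushoutI φ) :=
      ⟨NSS ((Monoid.PushoutI.of i₀ : G i₀ →* Monoid.PushoutI φ) '' R), mul_mem_NSS⟩
    refine ⟨fun j => N.comap (Monoid.PushoutI.of j : G j →* Monoid.PushoutI φ).toMulHom,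
      fun j x hx g => ?_, fun r hr => ?_, fun h₁ => ?_, fun j j' => ?_⟩
    · change Monoid.PushoutI.of j (g⁻¹ * x * g) ∈ NSS _
      rw [map_mul, map_mul, map_inv]
      exact conj_mem_NSS hx _
    · exact subset_NSS ⟨r, hr, rfl⟩
    · refine h ?_
      rw [← map_one (Monoid.PushoutI.of i₀ : G i₀ →* Monoid.PushoutI φ)]
      exact h₁
    · ext c
      change Monoid.PushoutI.of j (φ j c) ∈ NSS _ ↔ Monoid.PushoutI.of j' (φ j' c) ∈ NSS _
      rw [Monoid.PushoutI.of_apply_eq_base, Monoid.PushoutI.of_apply_eq_base]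
  · rintro ⟨P, hP, hRP, h1, hC⟩ ⟨l, hl, hlR, hprod⟩
    have : Nonempty I := ⟨i₀⟩
    have hA : Monoid.PushoutI.IsCompatible φ fun i => (P i).insertOne := by
      refine ⟨fun i x hx g => ?_, fun i j c hc => ?_⟩
      · rcases hx with rfl | hx
        · simp
        · exact Or.inr (hP i x hx g)
      · rcases hc with hc | hc
        -- Injectivity ensures that adjoining 1 keeps the traces on `C` equal.
        · rw [(map_eq_one_iff (φ i) (hφ i)).1 hc, map_one]
          exact one_mem _
        · exact Or.inr ((Set.ext_iff.1 (hC i j) c).1 hc)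
    obtain ⟨N, hN, hNA⟩ := Monoid.PushoutI.exists_normal_submonoid hA
    have hmem : ∀ p ∈ l, p.2⁻¹ * p.1 * p.2 ∈ N := by
      intro p hp
      obtain ⟨r, hr, hrp⟩ := hlR p hp
      rw [← hrp]
      exact hN _ ((hNA i₀ r).2 (Or.inr (hRP hr))) _
    obtain ⟨p, l, rfl⟩ := List.exists_cons_of_ne_nil hl
    obtain ⟨r, hr, hrp⟩ := hlR p List.mem_cons_self
    have htail : (l.map fun p => p.2⁻¹ * p.1 * p.2).prod ∈ N :=
      N.list_prod_mem fun x hx => by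
        obtain ⟨q, hq, rfl⟩ := List.mem_map.1 hx
        exact hmem q (List.mem_cons_of_mem _ hq)
    rw [List.map_cons, List.prod_cons, mul_eq_one_iff_inv_eq] at hprod
    -- The tail of the product is the inverse of its first factor, a conjugate of `r⁻¹`.
    have hr' : (Monoid.PushoutI.of i₀ r⁻¹ : Monoid.PushoutI φ) ∈ N := by
      have := hN _ htail p.2⁻¹
      rw [← hprod] at this
      convert this using 1
      rw [map_inv, hrp]
      group
    rcases (hNA i₀ _).1 hr' with h | h
    · exact hR (inv_eq_one.1 h ▸ hr)
    · exact h1 (by simpa using mul_mem h (hRP hr))
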